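/- Let $n\ge 1$ be an integer. Let $\widetilde T$ be the set of classes, in the quotient group $\mathbb{Z}^2/\mathbb{Z}\cdot(n,n)$, of pairs $(i,j)$ with $i<j$ and $i\not\equiv j \bmod n$; we write $(i,j)$ also for its class. A subset $J\subseteq\widetilde T$ is called closed if for all integers $i<j<k$: 1. if $(i,j),(j,k)\in J$ and $i\not\equiv k \bmod n$, then $(i,k)\in J$; 2. if $(i,j),(j,k)\in J$ and $i\equiv k \bmod n$, then $(i,j+\ell n)\in J$ and $(j,k+\ell n)\in J$ for all integers $\ell\ge 0$; 3. if $(i,j),(i,k)\in J$ and $j\equiv k \bmod n$, then $(i,j+\ell n)\in J$ for all integers $\ell$ with $j\le j+\ell n\le k$. The set $J$ is called biclosed if both $J$ and $\widetilde T\setminus J$ are closed. A translationally invariant total order is a total order $\prec$ on $\mathbb{Z}$ such that $i\prec j$ if and only if $i+n\prec j+n$, for all $i,j\in\mathbb{Z}$. Put $I(\prec)=\{(i,j)\in\widetilde T : i<j,\ i\succ j\}$. A residue class $r+n\mathbb{Z}$ is an interval of $\prec$ if $a\prec b\prec c$ with $a,c\in r+n\mathbb{Z}$ implies $b\in r+n\mathbb{Z}$.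 Two translationally invariant total orders are called equivalent if one is obtained from the other by reversing the order within each member of some (possibly empty) set of residue classes modulo $n$ that are intervals; this is an equivalence relation. Then the map $\prec\;\mapsto I(\prec)$ induces a well-defined bijection from the set of equivalence classes of translationally invariant total orders on $\mathbb{Z}$ to the set of biclosed subsets of $\widetilde T$. -/

import Mathlib

namespace AffineA

/-- The quotient of `ℤ²` by the subgroup `ℤ · (n, n)`. -/
abbrev PairClass (n : ℕ) : Type :=
  (ℤ × ℤ) ⧸ AddSubgroup.zmultiples ((n : ℤ), (n : ℤ))

/-- The class of the pair `(i, j)` modulo `ℤ · (n, n)`. -/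
def pairClass (n : ℕ) (i j : ℤ) : PairClass n :=
  QuotientAddGroup.mk (i, j)

/-- The root set: classes of pairs `(i, j)` with `i < j` and `i ≢ j mod n`. -/
def rootSet (n : ℕ) : Set (PairClass n) :=
  {x | ∃ i j : ℤ, i < j ∧ ¬ i ≡ j [ZMOD n] ∧ pairClass n i j = x}

/-- The three closure conditions on a subset of the root set. -/
structure IsClosedSet (n : ℕ) (J : Set (PairClass n)) : Prop where
  subset : J ⊆ rootSet n
  cond_one : ∀ i j k : ℤ, i < j → j < k → pairClass n i j ∈ J → pairClass n j k ∈ J →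
    ¬ i ≡ k [ZMOD n] → pairClass n i k ∈ J
  cond_two : ∀ i j k : ℤ, i < j → j < k → pairClass n i j ∈ J → pairClass n j k ∈ J →
    i ≡ k [ZMOD n] →
    ∀ l : ℤ, 0 ≤ l → pairClass n i (j + l * n) ∈ J ∧ pairClass n j (k + l * n) ∈ J
  cond_three : ∀ i j k : ℤ, i < j → j < k → pairClass n i j ∈ J → pairClass n i k ∈ J →
    j ≡ k [ZMOD n] →
    ∀ l : ℤ, j ≤ j + l * n → j + l * n ≤ k → pairClass n i (j + l * n) ∈ J

/-- A subset of the root set is biclosed if it and its complement in the root set are closed. -/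
structure IsBiclosed (n : ℕ) (J : Set (PairClass n)) : Prop where
  closed : IsClosedSet n J
  coclosed : IsClosedSet n (rootSet n \ J)

/-- A (strict) total order on `ℤ` that is invariant under translation by `n`. -/
@[ext]
structure InvariantOrder (n : ℕ) where
  lt : ℤ → ℤ → Prop
  irrefl : ∀ i, ¬ lt i i
  trans : ∀ i j k, lt i j → lt j k → lt i k
  total : ∀ i j, lt i j ∨ i = j ∨ lt j i
  invariant : ∀ i j, lt i j ↔ lt (i + n) (j + n)

namespace InvariantOrder

variable {n : ℕ}

/-- `I(≺)`: the classes in the root set of pairs `(i, j)` with `i < j`, `i ≢ j mod n`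
and `i ≻ j`. -/
def inversionSet (o : InvariantOrder n) : Set (PairClass n) :=
  {x | ∃ i j : ℤ, i < j ∧ ¬ i ≡ j [ZMOD n] ∧ o.lt j i ∧ pairClass n i j = x}

/-- The residue class `r` is an interval for `≺`: whatever lies between two of its members
belongs to it. -/
def IsIntervalClass (o : InvariantOrder n) (r : ZMod n) : Prop :=
  ∀ a b c : ℤ, (a : ZMod n) = r → (c : ZMod n) = r → o.lt a b → o.lt b c → (b : ZMod n) = r

/-- `o'` arises from `o` by reversing each residue class in `S`. -/
def ReversesOn (o o' : InvariantOrder n) (S : Set (ZMod n)) : Prop :=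
  (∀ i j : ℤ, (i : ZMod n) = j → (i : ZMod n) ∈ S → (o'.lt i j ↔ o.lt j i)) ∧
  (∀ i j : ℤ, ¬ ((i : ZMod n) = j ∧ (i : ZMod n) ∈ S) → (o'.lt i j ↔ o.lt i j))

/-- `o` and `o'` differ by reversing some residue classes, each of which is an interval. -/
def ReversalEquiv (o o' : InvariantOrder n) : Prop :=
  ∃ S : Set (ZMod n), (∀ r ∈ S, o.IsIntervalClass r) ∧ o.ReversesOn o' S

theorem ReversesOn.isIntervalClass {o o' : InvariantOrder n} {S : Set (ZMod n)}
    (h : o.ReversesOn o' S) {r : ZMod n} (hr : o.IsIntervalClass r) :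
    o'.IsIntervalClass r := by
  intro a b c ha hc hab hbc
  by_contra hb
  have h1 := (h.2 a b (fun h => hb (h.1 ▸ ha))).1 hab
  have h2 := (h.2 b c (fun h => hb (h.1.trans hc))).1 hbc
  exact hb (hr a b c ha hc h1 h2)

theorem ReversesOn.symm {o o' : InvariantOrder n} {S : Set (ZMod n)}
    (h : o.ReversesOn o' S) : o'.ReversesOn o S :=
  ⟨fun i j hij hi => (h.1 j i hij.symm (hij ▸ hi)).symm, fun i j hij => (h.2 i j hij).symm⟩

theorem reversalEquiv_equivalence : Equivalence (ReversalEquiv (n := n)) where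
  refl o := ⟨∅, by simp, by simp [ReversesOn]⟩
  symm := by
    rintro o o' ⟨S, hS, h⟩
    exact ⟨S, fun r hr => h.isIntervalClass (hS r hr), h.symm⟩
  trans := by
    rintro o o' o'' ⟨S, hS, h⟩ ⟨S', hS', h'⟩
    refine ⟨symmDiff S S', ?_, ?_, ?_⟩
    · rintro r (⟨hr, -⟩ | ⟨hr, -⟩)
      · exact hS r hr
      · exact h.symm.isIntervalClass (hS' r hr)
    · rintro i j hij (⟨hi, hi'⟩ | ⟨hi, hi'⟩)
      · rw [h'.2 i j (fun k => hi' k.2), h.1 i j hij hi]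
      · rw [h'.1 i j hij hi, h.2 j i (fun k => hi' (hij ▸ k.2))]
    · intro i j hij
      by_cases e : (i : ZMod n) = j
      · by_cases hi : (i : ZMod n) ∈ S
        · by_cases hi' : (i : ZMod n) ∈ S'
          · rw [h'.1 i j e hi', h.1 j i e.symm (e ▸ hi)]
          · exact absurd ⟨e, Or.inl ⟨hi, hi'⟩⟩ hij
        · by_cases hi' : (i : ZMod n) ∈ S'
          · exact absurd ⟨e, Or.inr ⟨hi', hi⟩⟩ hij
          · rw [h'.2 i j (fun k => hi' k.2), h.2 i j (fun k => hi k.2)]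
      · rw [h'.2 i j (fun k => e k.1), h.2 i j (fun k => e k.1)]

/-- Invariant orders up to reversal of residue classes that are intervals. -/
def reversalSetoid (n : ℕ) : Setoid (InvariantOrder n) :=
  ⟨ReversalEquiv, reversalEquiv_equivalence⟩

end InvariantOrder

end AffineA

namespace AffineA

/-! ### Pairs modulo translation. -/

variable {n : ℕ}

/-! `I(≺)` records exactly how `≺` compares incongruent integers, while invariance makes `≺`
monotone on each residue class. So only the directions of the classes can differ between orders with
equal inversion sets, and an element of another class lying between two members fixes the direction:
classes that differ are intervals.

For surjectivity, `J` prescribes a relation `Precedes` between incongruent integers, and each class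
must be given a direction. An ascent (`HasAscent`) forces increase, an ascent for the complement
forces decrease, and a class with neither may go either way. The crux is
`IsBiclosed.not_hasAscent_compl`: both cannot occur. By `IsBiclosed.precedes_of_ascent`, an ascent
at `i` through `j` puts far right translates of `j` after `i` and far left ones before it; a descent
through `k` does the opposite. Comparing `j` and `k` at both ends contradicts invariance. -/

theorem pairClass_eq_iff {i j i' j' : ℤ} :
    pairClass n i j = pairClass n i' j' ↔ ∃ m : ℤ, i' = i + m * n ∧ j' = j + m * n := by
  unfold pairClass
  rw [QuotientAddGroup.eq, AddSubgroup.mem_zmultiples_iff]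
  constructor
  · rintro ⟨m, hm⟩
    simp only [Prod.ext_iff, Prod.smul_mk, smul_eq_mul, Prod.mk_add_mk, Prod.neg_mk] at hm
    exact ⟨m, by linarith [hm.1], by linarith [hm.2]⟩
  · rintro ⟨m, rfl, rfl⟩
    exact ⟨m, by simp⟩

theorem pairClass_add_mul (i j m : ℤ) :
    pairClass n (i + m * n) (j + m * n) = pairClass n i j :=
  (pairClass_eq_iff.2 ⟨m, rfl, rfl⟩).symm

theorem pairClass_mem_rootSet {i j : ℤ} (h : i < j) (hij : ¬ i ≡ j [ZMOD n]) :
    pairClass n i j ∈ rootSet n :=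
  ⟨i, j, h, hij, rfl⟩

theorem exists_eq_add_mul {i j : ℤ} (h : i ≡ j [ZMOD n]) : ∃ m : ℤ, j = i + m * n := by
  obtain ⟨m, hm⟩ := h.dvd
  exact ⟨m, by linarith⟩

theorem add_mul_modEq (i m : ℤ) : i + m * n ≡ i [ZMOD n] := by
  simp [Int.ModEq]

theorem add_mul_modEq_add_mul_iff (i j m : ℤ) :
    i + m * n ≡ j + m * n [ZMOD n] ↔ i ≡ j [ZMOD n] :=
  ⟨fun h => h.add_right_cancel' _, fun h => h.add_right _⟩

theorem not_modEq_of_pairClass_mem {J : Set (PairClass n)} (hJ : J ⊆ rootSet n) {i j : ℤ}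
    (h : pairClass n i j ∈ J) : ¬ i ≡ j [ZMOD n] := by
  obtain ⟨a, b, -, hab, e⟩ := hJ h
  obtain ⟨m, rfl, rfl⟩ := pairClass_eq_iff.1 e
  rwa [add_mul_modEq_add_mul_iff]

/-! ### Inversion sets of invariant orders are biclosed. -/

namespace InvariantOrder

theorem asymm (o : InvariantOrder n) {i j : ℤ} (h : o.lt i j) : ¬ o.lt j i :=
  fun h' => o.irrefl i (o.trans _ _ _ h h')

theorem lt_of_not_lt (o : InvariantOrder n) {i j : ℤ} (hne : i ≠ j) (h : ¬ o.lt i j) :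
    o.lt j i :=
  ((o.total i j).resolve_left h).resolve_left hne

theorem lt_add_mul_iff (o : InvariantOrder n) (i j m : ℤ) :
    o.lt (i + m * n) (j + m * n) ↔ o.lt i j := by
  induction m using Int.induction_on with
  | zero => simp
  | succ k ih =>
    rw [← ih, o.invariant (i + k * n)]
    ring_nf
  | pred k ih =>
    rw [← ih, o.invariant (i + (-k - 1) * n)]
    ring_nf

/-- The order opposite to `o`. -/
def reverse (o : InvariantOrder n) : InvariantOrder n where
  lt i j := o.lt j i
  irrefl := o.irrefl
  trans i j k h h' := o.trans k j i h' h
  total i j := (o.total j i).imp id (Or.imp Eq.symm id)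
  invariant i j := o.invariant j i

theorem lt_add_mul_of_lt_add (o : InvariantOrder n) {i : ℤ} (h : o.lt i (i + n)) (k : ℕ) :
    o.lt i (i + (k + 1 : ℕ) * n) := by
  induction k with
  | zero => simpa using h
  | succ k ih =>
    have := (o.lt_add_mul_iff i (i + n) (k + 1 : ℕ)).2 h
    refine o.trans _ _ _ ih ?_
    convert this using 1
    push_cast; ring

theorem lt_of_lt_add (o : InvariantOrder n) {i a b : ℤ} (h : o.lt i (i + n))
    (ha : a ≡ i [ZMOD n]) (hb : b ≡ i [ZMOD n]) (hab : a < b) : o.lt a b := by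
  obtain ⟨x, rfl⟩ := exists_eq_add_mul ha.symm
  obtain ⟨y, rfl⟩ := exists_eq_add_mul hb.symm
  have hxy : x < y := by
    by_contra! hyx
    have : y * (n : ℤ) ≤ x * n := by gcongr
    linarith
  obtain ⟨k, hk⟩ := Int.eq_ofNat_of_zero_le (show 0 ≤ y - x - 1 by omega)
  have := (o.lt_add_mul_iff _ _ x).2 (o.lt_add_mul_of_lt_add h k)
  convert this using 1
  obtain rfl : y = x + 1 + k := by linarith
  push_cast; ring

/-- By invariance, the comparison of `i` with `i + n` propagates along the whole class. -/
theorem lt_on_class_or_gt_on_class (o : InvariantOrder n) (i : ℤ) :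
    (∀ a b : ℤ, a ≡ i [ZMOD n] → b ≡ i [ZMOD n] → a < b → o.lt a b) ∨
    (∀ a b : ℤ, a ≡ i [ZMOD n] → b ≡ i [ZMOD n] → a < b → o.lt b a) := by
  rcases o.total i (i + n) with h | h | h
  · exact Or.inl fun a b => o.lt_of_lt_add h
  · refine Or.inl fun a b ha hb hab => absurd hab ?_
    obtain rfl : n = 0 := by omega
    have := Int.modEq_zero_iff.1 (by simpa using ha)
    have := Int.modEq_zero_iff.1 (by simpa using hb)
    omega
  · exact Or.inr fun a b => o.reverse.lt_of_lt_add h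

theorem pairClass_mem_inversionSet_iff (o : InvariantOrder n) {i j : ℤ} (h : i < j)
    (hij : ¬ i ≡ j [ZMOD n]) : pairClass n i j ∈ o.inversionSet ↔ o.lt j i := by
  constructor
  · rintro ⟨a, b, -, -, hlt, e⟩
    obtain ⟨m, rfl, rfl⟩ := pairClass_eq_iff.1 e
    exact (o.lt_add_mul_iff _ _ _).2 hlt
  · exact fun hlt => ⟨i, j, h, hij, hlt, rfl⟩

theorem inversionSet_subset_rootSet (o : InvariantOrder n) : o.inversionSet ⊆ rootSet n := by
  rintro x ⟨i, j, h, hij, -, e⟩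
  exact ⟨i, j, h, hij, e⟩

theorem rootSet_diff_inversionSet (o : InvariantOrder n) :
    rootSet n \ o.inversionSet = o.reverse.inversionSet := by
  ext x
  constructor
  · rintro ⟨⟨i, j, h, hij, rfl⟩, hx⟩
    rw [o.pairClass_mem_inversionSet_iff h hij] at hx
    exact ⟨i, j, h, hij, o.lt_of_not_lt h.ne' hx, rfl⟩
  · rintro ⟨i, j, h, hij, hlt, rfl⟩
    refine ⟨pairClass_mem_rootSet h hij, ?_⟩
    rw [o.pairClass_mem_inversionSet_iff h hij]
    exact o.asymm hlt

theorem inversionSet_isClosedSet (o : InvariantOrder n) : IsClosedSet n o.inversionSet where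
  subset := o.inversionSet_subset_rootSet
  cond_one i j k hij hjk h1 h2 hik := by
    rw [o.pairClass_mem_inversionSet_iff hij
      (not_modEq_of_pairClass_mem o.inversionSet_subset_rootSet h1)] at h1
    rw [o.pairClass_mem_inversionSet_iff hjk
      (not_modEq_of_pairClass_mem o.inversionSet_subset_rootSet h2)] at h2
    rw [o.pairClass_mem_inversionSet_iff (hij.trans hjk) hik]
    exact o.trans _ _ _ h2 h1
  cond_two i j k hij hjk h1 h2 hik l hl := by
    have nij := not_modEq_of_pairClass_mem o.inversionSet_subset_rootSet h1
    have njk := not_modEq_of_pairClass_mem o.inversionSet_subset_rootSet h2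
    rw [o.pairClass_mem_inversionSet_iff hij nij] at h1
    rw [o.pairClass_mem_inversionSet_iff hjk njk] at h2
    have hln : 0 ≤ l * (n : ℤ) := by positivity
    -- One descent inside a class makes the whole class decreasing, so moving `z` up only moves it
    -- earlier. Here `k ≺ j ≺ i` gives a descent in the class of `i`, and, with a translate of `j ≺
    -- i`, one in the class of `j`.
    have key : ∀ x y : ℤ, x ≡ y [ZMOD n] → x < y → o.lt y x →
        ∀ z : ℤ, z ≡ x [ZMOD n] → ∀ w, o.lt z w → o.lt (z + l * n) w := by
      intro x y hxy hlt hyx z hz w hw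
      rcases o.lt_on_class_or_gt_on_class x with h | h
      · exact absurd hyx (o.asymm (h x y (Int.ModEq.refl x) hxy.symm hlt))
      · rcases hln.eq_or_lt with h0 | h0
        · rwa [← h0, add_zero]
        · exact o.trans _ _ _ (h z (z + l * n) hz ((add_mul_modEq z l).trans hz) (by linarith)) hw
    obtain ⟨m, rfl⟩ := exists_eq_add_mul hik
    rw [o.pairClass_mem_inversionSet_iff (by linarith)
        (fun h => nij (h.trans (add_mul_modEq j l))),
      o.pairClass_mem_inversionSet_iff (by linarith)
        (fun h => njk (h.trans (add_mul_modEq _ l)))]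
    refine ⟨key j (j + m * n) (add_mul_modEq j m).symm (by linarith)
      (o.trans _ _ _ ((o.lt_add_mul_iff _ _ m).2 h1) h2) j (Int.ModEq.refl j) i h1, ?_⟩
    exact key i (i + m * n) hik (by linarith) (o.trans _ _ _ h2 h1) _ (add_mul_modEq i m) j h2
  cond_three i j k hij hjk h1 h2 hmod l hl hl' := by
    have nij := not_modEq_of_pairClass_mem o.inversionSet_subset_rootSet h1
    rw [o.pairClass_mem_inversionSet_iff hij nij] at h1
    rw [o.pairClass_mem_inversionSet_iff (hij.trans hjk) (fun h => nij (h.trans hmod.symm))] at h2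
    rw [o.pairClass_mem_inversionSet_iff (hij.trans_le hl)
        (fun h => nij (h.trans (add_mul_modEq j l)))]
    rcases o.lt_on_class_or_gt_on_class j with h | h
    · rcases hl'.eq_or_lt with e | hlt
      · rwa [e]
      · exact o.trans _ _ _ (h _ k (add_mul_modEq j l) hmod.symm hlt) h2
    · rcases hl.eq_or_lt with e | hlt
      · rwa [← e]
      · exact o.trans _ _ _ (h j _ (Int.ModEq.refl j) (add_mul_modEq j l) hlt) h1

theorem inversionSet_isBiclosed (o : InvariantOrder n) : IsBiclosed n o.inversionSet where
  closed := o.inversionSet_isClosedSet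
  coclosed := o.rootSet_diff_inversionSet ▸ o.reverse.inversionSet_isClosedSet

/-! ### Fibres of the inversion map. -/

theorem ReversalEquiv.inversionSet_eq {o o' : InvariantOrder n} (h : o.ReversalEquiv o') :
    o.inversionSet = o'.inversionSet := by
  obtain ⟨S, -, -, h⟩ := h
  ext x
  refine exists₂_congr fun i j => and_congr_right fun _ => and_congr_right fun hij => ?_
  rw [h j i fun e => hij ((ZMod.intCast_eq_intCast_iff _ _ _).1 e.1.symm)]

theorem lt_iff_of_inversionSet_eq {o o' : InvariantOrder n}
    (h : o.inversionSet = o'.inversionSet) {i j : ℤ} (hij : ¬ i ≡ j [ZMOD n]) :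
    o'.lt i j ↔ o.lt i j := by
  have key : ∀ a b : ℤ, a < b → ¬ a ≡ b [ZMOD n] → (o'.lt b a ↔ o.lt b a) := by
    intro a b hab hn
    rw [← pairClass_mem_inversionSet_iff o hab hn, h, pairClass_mem_inversionSet_iff o' hab hn]
  have hne : i ≠ j := fun e => hij (e ▸ Int.ModEq.refl i)
  rcases hne.lt_or_gt with hlt | hlt
  · have := key i j hlt hij
    constructor
    · exact fun h1 => o.lt_of_not_lt hne.symm fun h2 => o'.asymm h1 (this.2 h2)
    · exact fun h1 => o'.lt_of_not_lt hne.symm fun h2 => o.asymm h1 (this.1 h2)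
  · exact key j i hlt fun e => hij e.symm

theorem reversalEquiv_of_inversionSet_eq {o o' : InvariantOrder n}
    (h : o.inversionSet = o'.inversionSet) : o.ReversalEquiv o' := by
  refine ⟨{r | ∃ a b : ℤ, (a : ZMod n) = r ∧ (b : ZMod n) = r ∧ o.lt a b ∧ o'.lt b a},
    ?_, ?_, ?_⟩
  · rintro r ⟨a, b, ha, hb, hab, hba⟩ x y z hx hz hxy hyz
    by_contra hy
    have nxy : ¬ x ≡ y [ZMOD n] := fun e =>
      hy (((ZMod.intCast_eq_intCast_iff _ _ _).2 e).symm.trans hx)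
    have nyz : ¬ y ≡ z [ZMOD n] := fun e =>
      hy (((ZMod.intCast_eq_intCast_iff _ _ _).2 e).trans hz)
    have h1 := o.trans _ _ _ hxy hyz
    have h2 := o'.trans _ _ _ ((lt_iff_of_inversionSet_eq h nxy).2 hxy)
      ((lt_iff_of_inversionSet_eq h nyz).2 hyz)
    have ha' := (ZMod.intCast_eq_intCast_iff _ _ _).1 (ha.trans hx.symm)
    have hb' := (ZMod.intCast_eq_intCast_iff _ _ _).1 (hb.trans hx.symm)
    have hz' := (ZMod.intCast_eq_intCast_iff _ _ _).1 (hz.trans hx.symm)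
    have hx' := Int.ModEq.refl (n := n) x
    have hab_ne : a ≠ b := fun e => o.irrefl a (e ▸ hab)
    have hxz_ne : x ≠ z := fun e => o.irrefl x (e ▸ h1)
    -- The orders have opposite directions on this class because of `a`, `b`, yet both put `x`
    -- before `z` because of `y`.
    rcases o.lt_on_class_or_gt_on_class x with u | u <;>
    rcases o'.lt_on_class_or_gt_on_class x with v | v <;>
    rcases hab_ne.lt_or_gt with s | s <;>
    rcases hxz_ne.lt_or_gt with t | t <;>
    first
    | exact o.asymm hab (u _ _ ‹_› ‹_› s)
    | exact o'.asymm hba (v _ _ ‹_› ‹_› s)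
    | exact o.asymm h1 (u _ _ ‹_› ‹_› t)
    | exact o'.asymm h2 (v _ _ ‹_› ‹_› t)
  · rintro i j hij ⟨a, b, ha, hb, hab, hba⟩
    have hj := (ZMod.intCast_eq_intCast_iff _ _ _).1 hij.symm
    have ha' := (ZMod.intCast_eq_intCast_iff _ _ _).1 ha
    have hb' := (ZMod.intCast_eq_intCast_iff _ _ _).1 hb
    have hi := Int.ModEq.refl (n := n) i
    have hab_ne : a ≠ b := fun e => o.irrefl a (e ▸ hab)
    rcases eq_or_ne i j with rfl | hne
    · simp [irrefl]
    rcases o.lt_on_class_or_gt_on_class i with u | u <;>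
    rcases o'.lt_on_class_or_gt_on_class i with v | v <;>
    rcases hab_ne.lt_or_gt with s | s <;>
    rcases hne.lt_or_gt with t | t <;>
    first
    | exact absurd (u _ _ ‹_› ‹_› s) (o.asymm hab)
    | exact absurd (v _ _ ‹_› ‹_› s) (o'.asymm hba)
    | exact iff_of_true (v _ _ ‹_› ‹_› t) (u _ _ ‹_› ‹_› t)
    | exact iff_of_false (o'.asymm (v _ _ ‹_› ‹_› t)) (o.asymm (u _ _ ‹_› ‹_› t))
  · intro i j hij
    by_cases e : (i : ZMod n) = j
    · rcases eq_or_ne i j with rfl | hne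
      · simp [irrefl]
      have hS := fun hi => hij ⟨e, hi⟩
      constructor
      · intro h1
        by_contra h2
        exact hS ⟨j, i, e.symm, rfl, o.lt_of_not_lt hne h2, h1⟩
      · intro h1
        by_contra h2
        exact hS ⟨i, j, rfl, e.symm, h1, o'.lt_of_not_lt hne h2⟩
    · exact lt_iff_of_inversionSet_eq h fun k => e ((ZMod.intCast_eq_intCast_iff _ _ _).2 k)

end InvariantOrder

/-! ### The relation between classes prescribed by a biclosed set. -/

/-- The relation on pairs of incongruent integers whose inversions form `J`. -/
def Precedes (J : Set (PairClass n)) (i j : ℤ) : Prop :=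
  (i < j ∧ pairClass n i j ∉ J) ∨ (j < i ∧ pairClass n j i ∈ J)

/-- Some element of another class lies between two members of the class of `i`,
the smaller of which comes first. -/
def HasAscent (J : Set (PairClass n)) (i : ℤ) : Prop :=
  ∃ a b j : ℤ, a ≡ i [ZMOD n] ∧ b ≡ i [ZMOD n] ∧ a < b ∧ ¬ i ≡ j [ZMOD n] ∧
    Precedes J a j ∧ Precedes J j b

section Precedes

variable {J : Set (PairClass n)}

theorem precedes_or_precedes {i j : ℤ} (hne : i ≠ j) : Precedes J i j ∨ Precedes J j i := by
  unfold Precedes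
  rcases hne.lt_or_gt with h | h <;> tauto

theorem Precedes.asymm {i j : ℤ} (h : Precedes J i j) : ¬ Precedes J j i := by
  rintro (⟨h1, h2⟩ | ⟨h1, h2⟩) <;> rcases h with ⟨h3, h4⟩ | ⟨h3, h4⟩
  · exact absurd h1 (lt_asymm h3)
  · exact h2 h4
  · exact h4 h2
  · exact absurd h1 (lt_asymm h3)

theorem precedes_add_mul_iff (i j m : ℤ) :
    Precedes J (i + m * n) (j + m * n) ↔ Precedes J i j := by
  simp [Precedes, pairClass_add_mul]

theorem precedes_compl_iff {i j : ℤ} (hij : ¬ i ≡ j [ZMOD n]) :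
    Precedes (rootSet n \ J) i j ↔ Precedes J j i := by
  have hji : ¬ j ≡ i [ZMOD n] := fun h => hij h.symm
  have h1 := fun h => pairClass_mem_rootSet (n := n) (i := i) (j := j) h hij
  have h2 := fun h => pairClass_mem_rootSet (n := n) (i := j) (j := i) h hji
  simp only [Precedes, Set.mem_sdiff]
  tauto

theorem IsBiclosed.compl (hJ : IsBiclosed n J) : IsBiclosed n (rootSet n \ J) where
  closed := hJ.coclosed
  coclosed := by
    rw [Set.sdiff_sdiff_cancel_left hJ.closed.subset]
    exact hJ.closed

/-- A failure would be a 3-cycle. Around it either two steps go up and one down, against `cond_one`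
for the complement, or two go down and one up, against `cond_one` for `J`. -/
theorem IsBiclosed.precedes_trans (hJ : IsBiclosed n J) {i j k : ℤ} (hij : ¬ i ≡ j [ZMOD n])
    (hjk : ¬ j ≡ k [ZMOD n]) (hik : ¬ i ≡ k [ZMOD n]) (h1 : Precedes J i j)
    (h2 : Precedes J j k) : Precedes J i k := by
  have hji : ¬ j ≡ i [ZMOD n] := fun h => hij h.symm
  have hkj : ¬ k ≡ j [ZMOD n] := fun h => hjk h.symm
  have hki : ¬ k ≡ i [ZMOD n] := fun h => hik h.symm
  by_contra h3
  have hne : i ≠ k := by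
    rintro rfl
    exact hik (Int.ModEq.refl i)
  replace h3 := (precedes_or_precedes hne).resolve_left h3
  have up : ∀ a b c : ℤ, ¬ a ≡ b [ZMOD n] → ¬ b ≡ c [ZMOD n] → ¬ a ≡ c [ZMOD n] → a < b →
      b < c → pairClass n a b ∉ J → pairClass n b c ∉ J → pairClass n a c ∉ J :=
    fun a b c hab hbc hac l1 l2 m1 m2 => (hJ.coclosed.cond_one a b c l1 l2
      ⟨pairClass_mem_rootSet l1 hab, m1⟩ ⟨pairClass_mem_rootSet l2 hbc, m2⟩ hac).2
  have down := hJ.closed.cond_one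
  rcases h1 with ⟨l1, m1⟩ | ⟨l1, m1⟩ <;> rcases h2 with ⟨l2, m2⟩ | ⟨l2, m2⟩ <;>
    rcases h3 with ⟨l3, m3⟩ | ⟨l3, m3⟩
  · omega
  · exact up i j k hij hjk hik l1 l2 m1 m2 m3
  · exact up k i j hki hij hkj l3 l1 m3 m1 m2
  · exact m1 (down i k j l3 l2 m3 m2 hij)
  · exact up j k i hjk hki hji l2 l3 m2 m3 m1
  · exact m2 (down j i k l1 l3 m1 m3 hjk)
  · exact m3 (down k j i l2 l1 m2 m1 hki)
  · omega

/-! ### Ascents and their incompatibility with descents. -/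

theorem IsBiclosed.precedes_of_ascent (hJ : IsBiclosed n J) {a b j : ℤ}
    (hab : a ≡ b [ZMOD n]) (hlt : a < b) (haj : ¬ a ≡ j [ZMOD n]) (h1 : Precedes J a j)
    (h2 : Precedes J j b) {y : ℤ} (hy : y ≡ j [ZMOD n]) :
    (b ≤ y → j ≤ y → Precedes J a y) ∧
      (y ≤ a - (b - a) → y ≤ j - (b - a) → Precedes J y a) := by
  have hja : ¬ j ≡ a [ZMOD n] := fun h => haj h.symm
  have hjb : ¬ j ≡ b [ZMOD n] := fun h => hja (h.trans hab.symm)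
  have hay : ¬ a ≡ y [ZMOD n] := fun h => haj (h.trans hy)
  have hne : a ≠ y := by
    rintro rfl
    exact hay (Int.ModEq.refl a)
  obtain ⟨p, rfl⟩ := exists_eq_add_mul hy.symm
  obtain ⟨q, rfl⟩ := exists_eq_add_mul hab
  have hn : (0 : ℤ) < n := by
    rcases (Nat.cast_nonneg (α := ℤ) n).eq_or_lt with h | h
    · rw [← h] at hlt
      simp at hlt
    · exact h
  have hq : 0 < q := pos_of_mul_pos_left (by linarith) hn.le
  have shift : ∀ c : ℤ, pairClass n (j + p * n) (a + c * n) = pairClass n j (a + (c - p) * n) := by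
    intro c
    rw [← pairClass_add_mul j _ p]
    congr 1
    ring
  have shift' : pairClass n (j + p * n) a = pairClass n j (a + (0 - p) * n) := by
    simpa using shift 0
  have p_nonneg : j ≤ j + p * n → 0 ≤ p := fun h =>
    nonneg_of_mul_nonneg_left (by linarith) hn
  have p_le : j + p * n ≤ j - (a + q * n - a) → 0 ≤ -p - q := fun h =>
    nonneg_of_mul_nonneg_left (b := (n : ℤ)) (by linarith) hn
  -- The cases are `a < j < b`, `j` above `b`, `j` below `a`, and an impossible one. The first is
  -- `cond_two` for the complement; in the other two, a wrong comparison with `y` would, by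
  -- `cond_two` or `cond_three` for `J`, reverse one of `h1`, `h2`.
  rcases h1 with ⟨l1, m1⟩ | ⟨l1, m1⟩ <;> rcases h2 with ⟨l2, m2⟩ | ⟨l2, m2⟩
  · have two := hJ.coclosed.cond_two a j (a + q * n) l1 l2 ⟨pairClass_mem_rootSet l1 haj, m1⟩
      ⟨pairClass_mem_rootSet l2 hjb, m2⟩ hab
    constructor
    · intro hb hj
      exact Or.inl ⟨by linarith, (two p (p_nonneg hj)).1.2⟩
    · intro hb hj
      refine Or.inl ⟨by linarith, ?_⟩
      have := (two _ (p_le hj)).2.2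
      rw [shift']
      convert this using 3
      ring
  · have m2' : pairClass n a (j - q * n) ∈ J := by
      rw [← pairClass_add_mul a _ q]
      simpa using m2
    constructor
    · intro hb hj
      refine Or.inl ⟨by linarith, fun hmem => m1 ?_⟩
      have := hJ.closed.cond_three a (j - q * n) (j + p * n) (by linarith) (by linarith) m2' hmem
        (by simp [Int.ModEq]) q (by linarith) (by linarith)
      simpa using this
    · intro hb hj
      refine Or.inl ⟨by linarith, fun hmem => m1 ?_⟩
      have := (hJ.closed.cond_two (j + p * n) a (j - q * n) (by linarith) (by linarith) hmem m2'
        (by simp [Int.ModEq]) q hq.le).2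
      simpa using this
  · constructor
    · intro hb hj
      refine Or.inl ⟨by linarith, fun hmem => m2 ?_⟩
      exact (hJ.closed.cond_two j a (j + p * n) l1 (by linarith) m1 hmem hy.symm q hq.le).1
    · intro hb hj
      refine Or.inl ⟨by linarith, fun hmem => m2 ?_⟩
      rw [shift'] at hmem
      have hle : q * (n : ℤ) ≤ (0 - p) * n := by linarith
      exact hJ.closed.cond_three j a (a + (0 - p) * n) l1 (by linarith) m1 hmem
        (add_mul_modEq _ _).symm q (by linarith) (by linarith)
  · linarith

theorem IsBiclosed.exists_bound_of_hasAscent (hJ : IsBiclosed n J) {i : ℤ}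
    (h : HasAscent J i) :
    0 < n ∧ ∃ j, ¬ i ≡ j [ZMOD n] ∧ ∃ B : ℤ, ∀ y : ℤ, y ≡ j [ZMOD n] →
      (B ≤ y → Precedes J i y) ∧ (y ≤ -B → Precedes J y i) := by
  obtain ⟨a, b, j, ha, hb, hlt, hij, h1, h2⟩ := h
  have hn : 0 < n := by
    rcases n.eq_zero_or_pos with rfl | h
    · have := Int.modEq_zero_iff.1 (by simpa using ha.trans hb.symm)
      omega
    · exact h
  obtain ⟨m, rfl⟩ := exists_eq_add_mul ha
  refine ⟨hn, j + m * n, fun h => hij (h.trans (add_mul_modEq _ _)),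
    |a + m * n| + |b + m * n| + |j + m * n| + |b - a|, fun y hy => ?_⟩
  have := hJ.precedes_of_ascent (a := a + m * n) (b := b + m * n)
    (by simpa [add_mul_modEq_add_mul_iff] using (ha.trans hb.symm)) (by linarith)
    (fun h => hij (h.trans (add_mul_modEq _ _)))
    ((precedes_add_mul_iff _ _ _).2 h1) ((precedes_add_mul_iff _ _ _).2 h2) hy
  have e : b + m * n - (a + m * n) = b - a := by ring
  rw [e] at this
  have a1 := abs_nonneg (a + m * n)
  have a2 := abs_nonneg (b + m * n)
  have a3 := abs_nonneg (j + m * n)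
  have a4 := abs_nonneg (b - a)
  have b1 := neg_abs_le (a + m * n)
  have b2 := le_abs_self (b + m * n)
  have b3 := neg_abs_le (j + m * n)
  have b4 := le_abs_self (j + m * n)
  have b5 := le_abs_self (b - a)
  exact ⟨fun h => this.1 (by linarith) (by linarith),
    fun h => this.2 (by linarith) (by linarith)⟩

theorem exists_mul_ge (hn : 0 < n) (C : ℤ) : ∃ m : ℤ, C ≤ m * n := by
  refine ⟨|C|, (le_abs_self C).trans (le_mul_of_one_le_right (abs_nonneg C) ?_)⟩
  exact_mod_cast hn

theorem IsBiclosed.not_hasAscent_compl (hJ : IsBiclosed n J) {i : ℤ} (h : HasAscent J i) :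
    ¬ HasAscent (rootSet n \ J) i := by
  intro h'
  obtain ⟨hn, j, hij, B, hB⟩ := hJ.exists_bound_of_hasAscent h
  obtain ⟨-, k, hik, B', hB'⟩ := hJ.compl.exists_bound_of_hasAscent h'
  have hcompl : ∀ y : ℤ, y ≡ k [ZMOD n] →
      (B' ≤ y → Precedes J y i) ∧ (y ≤ -B' → Precedes J i y) := by
    intro y hy
    have hiy : ¬ i ≡ y [ZMOD n] := fun h => hik (h.trans hy)
    have := hB' y hy
    rwa [precedes_compl_iff hiy, precedes_compl_iff fun h => hiy h.symm] at this
  -- Shifting by `m * n` either way takes both `j` and `k` beyond both bounds.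
  obtain ⟨m, hm⟩ := exists_mul_ge hn (|j| + |k| + |B| + |B'|)
  have a1 := abs_nonneg j
  have a2 := abs_nonneg k
  have a3 := abs_nonneg B
  have a4 := abs_nonneg B'
  have b1 := neg_abs_le j
  have b2 := neg_abs_le k
  have b3 := le_abs_self j
  have b4 := le_abs_self k
  have b5 := le_abs_self B
  have b6 := le_abs_self B'
  by_cases hjk : j ≡ k [ZMOD n]
  · exact ((hB (j + m * n) (add_mul_modEq _ _)).1 (by linarith)).asymm
      ((hcompl (j + m * n) ((add_mul_modEq _ _).trans hjk)).1 (by linarith))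
  · have hk : ∀ l : ℤ, ¬ k + l * n ≡ i [ZMOD n] := fun l h =>
      hik (h.symm.trans (add_mul_modEq _ _))
    have hj : ∀ l : ℤ, ¬ i ≡ j + l * n [ZMOD n] := fun l h =>
      hij (h.trans (add_mul_modEq _ _))
    have hkj : ∀ l : ℤ, ¬ k + l * n ≡ j + l * n [ZMOD n] := fun l h =>
      hjk ((add_mul_modEq_add_mul_iff _ _ _).1 h).symm
    have h1 := hJ.precedes_trans (hk m) (hj m) (hkj m)
      ((hcompl _ (add_mul_modEq _ _)).1 (by linarith)) ((hB _ (add_mul_modEq _ _)).1 (by linarith))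
    have h2 := hJ.precedes_trans (fun h => hj (-m) h.symm) (fun h => hk (-m) h.symm)
      (fun h => hkj (-m) h.symm)
      ((hB _ (add_mul_modEq _ _)).2 (by linarith)) ((hcompl _ (add_mul_modEq _ _)).2 (by linarith))
    rw [precedes_add_mul_iff] at h1 h2
    exact h1.asymm h2

theorem HasAscent.of_modEq {i i' : ℤ} (h : HasAscent J i) (hi : i ≡ i' [ZMOD n]) :
    HasAscent J i' := by
  obtain ⟨a, b, j, ha, hb, hlt, hij, h1, h2⟩ := h
  exact ⟨a, b, j, ha.trans hi, hb.trans hi, hlt, fun h => hij (hi.trans h), h1, h2⟩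

theorem hasAscent_or_hasAscent_compl {a b j : ℤ} (hab : a ≡ b [ZMOD n]) (hne : a ≠ b)
    (haj : ¬ a ≡ j [ZMOD n]) (h1 : Precedes J a j) (h2 : Precedes J j b) :
    (a < b ∧ HasAscent J a) ∨ (b < a ∧ HasAscent (rootSet n \ J) a) := by
  rcases hne.lt_or_gt with h | h
  · exact Or.inl ⟨h, a, b, j, Int.ModEq.refl a, hab.symm, h, haj, h1, h2⟩
  · refine Or.inr ⟨h, b, a, j, hab.symm, Int.ModEq.refl a, h, haj, ?_, ?_⟩
    · exact (precedes_compl_iff fun h => haj (hab.trans h)).2 h2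
    · exact (precedes_compl_iff fun h => haj h.symm).2 h1

/-! ### The total order built from a biclosed set. -/

open Classical in
/-- Compare incongruent integers by `J`, and order each class decreasingly exactly when the
complement of `J` has an ascent there. -/
def orderRel (J : Set (PairClass n)) (i j : ℤ) : Prop :=
  if i ≡ j [ZMOD n] then (if HasAscent (rootSet n \ J) i then j < i else i < j)
  else Precedes J i j

theorem orderRel_of_not_modEq {i j : ℤ} (h : ¬ i ≡ j [ZMOD n]) :
    orderRel J i j ↔ Precedes J i j := by
  simp [orderRel, h]

theorem orderRel_of_hasAscent_compl {i j : ℤ} (h : i ≡ j [ZMOD n])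
    (h' : HasAscent (rootSet n \ J) i) : orderRel J i j ↔ j < i := by
  simp [orderRel, h, h']

theorem orderRel_of_not_hasAscent_compl {i j : ℤ} (h : i ≡ j [ZMOD n])
    (h' : ¬ HasAscent (rootSet n \ J) i) : orderRel J i j ↔ i < j := by
  simp [orderRel, h, h']

theorem orderRel_irrefl (i : ℤ) : ¬ orderRel J i i := by
  by_cases h : HasAscent (rootSet n \ J) i
  · simp [orderRel_of_hasAscent_compl (Int.ModEq.refl i) h]
  · simp [orderRel_of_not_hasAscent_compl (Int.ModEq.refl i) h]

theorem orderRel_or_orderRel {i j : ℤ} (hne : i ≠ j) : orderRel J i j ∨ orderRel J j i := by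
  by_cases hij : i ≡ j [ZMOD n]
  · by_cases h : HasAscent (rootSet n \ J) i
    · rw [orderRel_of_hasAscent_compl hij h,
        orderRel_of_hasAscent_compl hij.symm (h.of_modEq hij)]
      exact hne.symm.lt_or_gt
    · rw [orderRel_of_not_hasAscent_compl hij h,
        orderRel_of_not_hasAscent_compl hij.symm fun h' => h (h'.of_modEq hij.symm)]
      exact hne.lt_or_gt
  · rw [orderRel_of_not_modEq hij, orderRel_of_not_modEq fun h => hij h.symm]
    exact precedes_or_precedes hne

theorem orderRel_asymm {i j : ℤ} (h1 : orderRel J i j) : ¬ orderRel J j i := by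
  by_cases hij : i ≡ j [ZMOD n]
  · by_cases h : HasAscent (rootSet n \ J) i
    · rw [orderRel_of_hasAscent_compl hij h] at h1
      rw [orderRel_of_hasAscent_compl hij.symm (h.of_modEq hij)]
      exact lt_asymm h1
    · rw [orderRel_of_not_hasAscent_compl hij h] at h1
      rw [orderRel_of_not_hasAscent_compl hij.symm fun h' => h (h'.of_modEq hij.symm)]
      exact lt_asymm h1
  · rw [orderRel_of_not_modEq hij] at h1
    rw [orderRel_of_not_modEq fun h => hij h.symm]
    exact h1.asymm

theorem orderRel_add_iff (i j : ℤ) : orderRel J (i + n) (j + n) ↔ orderRel J i j := by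
  have hi : i + n ≡ i [ZMOD n] := by simp [Int.ModEq]
  have hmod : i + n ≡ j + n [ZMOD n] ↔ i ≡ j [ZMOD n] := by
    simp
  have hprec : Precedes J (i + n) (j + n) ↔ Precedes J i j := by
    simpa using precedes_add_mul_iff (J := J) i j 1
  have hasc : HasAscent (rootSet n \ J) (i + n) ↔ HasAscent (rootSet n \ J) i :=
    ⟨fun h => h.of_modEq hi, fun h => h.of_modEq hi.symm⟩
  by_cases h : HasAscent (rootSet n \ J) i <;>
    simp only [orderRel, hmod, hprec, hasc, h, if_true, if_false, add_lt_add_iff_right]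

/-- The order returns correctly to a class after a visit to another class. -/
theorem IsBiclosed.orderRel_of_precedes_of_precedes (hJ : IsBiclosed n J) {a b j : ℤ}
    (hab : a ≡ b [ZMOD n]) (haj : ¬ a ≡ j [ZMOD n]) (h1 : Precedes J a j)
    (h2 : Precedes J j b) : orderRel J a b := by
  have hne : a ≠ b := by
    rintro rfl
    exact h1.asymm h2
  rcases hasAscent_or_hasAscent_compl hab hne haj h1 h2 with ⟨h, h'⟩ | ⟨h, h'⟩
  · rwa [orderRel_of_not_hasAscent_compl hab (hJ.not_hasAscent_compl h')]
  · rwa [orderRel_of_hasAscent_compl hab h']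

theorem IsBiclosed.orderRel_trans (hJ : IsBiclosed n J) {i j k : ℤ} (h1 : orderRel J i j)
    (h2 : orderRel J j k) : orderRel J i k := by
  by_cases hij : i ≡ j [ZMOD n]
  · by_cases hjk : j ≡ k [ZMOD n]
    · by_cases h : HasAscent (rootSet n \ J) i
      · rw [orderRel_of_hasAscent_compl hij h] at h1
        rw [orderRel_of_hasAscent_compl hjk (h.of_modEq hij)] at h2
        rw [orderRel_of_hasAscent_compl (hij.trans hjk) h]
        exact h2.trans h1
      · rw [orderRel_of_not_hasAscent_compl hij h] at h1
        rw [orderRel_of_not_hasAscent_compl hjk fun h' => h (h'.of_modEq hij.symm)] at h2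
        rw [orderRel_of_not_hasAscent_compl (hij.trans hjk) h]
        exact h1.trans h2
    · have hik : ¬ i ≡ k [ZMOD n] := fun h => hjk (hij.symm.trans h)
      have hne : i ≠ k := by
        rintro rfl
        exact hik (Int.ModEq.refl i)
      by_contra h3
      replace h3 := (orderRel_or_orderRel hne).resolve_left h3
      rw [orderRel_of_not_modEq fun h => hik h.symm] at h3
      rw [orderRel_of_not_modEq hjk] at h2
      -- If `k` came before `i`, the path from `j` through `k` to `i` would leave the class and
      -- return, placing `j` before `i`.
      exact orderRel_asymm h1 (hJ.orderRel_of_precedes_of_precedes hij.symm hjk h2 h3)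
  · rw [orderRel_of_not_modEq hij] at h1
    by_cases hjk : j ≡ k [ZMOD n]
    · have hik : ¬ i ≡ k [ZMOD n] := fun h => hij (h.trans hjk.symm)
      have hne : i ≠ k := by
        rintro rfl
        exact hik (Int.ModEq.refl i)
      by_contra h3
      replace h3 := (orderRel_or_orderRel hne).resolve_left h3
      rw [orderRel_of_not_modEq fun h => hik h.symm] at h3
      exact orderRel_asymm h2
        (hJ.orderRel_of_precedes_of_precedes hjk.symm (fun h => hik h.symm) h3 h1)
    · rw [orderRel_of_not_modEq hjk] at h2
      by_cases hik : i ≡ k [ZMOD n]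
      · exact hJ.orderRel_of_precedes_of_precedes hik hij h1 h2
      · rw [orderRel_of_not_modEq hik]
        exact hJ.precedes_trans hij hjk hik h1 h2

end Precedes

/-- The invariant order with inversion set `J`. -/
def IsBiclosed.toInvariantOrder {J : Set (PairClass n)} (hJ : IsBiclosed n J) :
    InvariantOrder n where
  lt := orderRel J
  irrefl := orderRel_irrefl
  trans _ _ _ := hJ.orderRel_trans
  total i j := by
    rcases eq_or_ne i j with h | h
    · exact Or.inr (Or.inl h)
    · exact (orderRel_or_orderRel h).imp id Or.inr
  invariant i j := (orderRel_add_iff i j).symm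

theorem IsBiclosed.inversionSet_toInvariantOrder {J : Set (PairClass n)}
    (hJ : IsBiclosed n J) : hJ.toInvariantOrder.inversionSet = J := by
  have key : ∀ i j : ℤ, i < j → ¬ i ≡ j [ZMOD n] →
      (hJ.toInvariantOrder.lt j i ↔ pairClass n i j ∈ J) := by
    intro i j h hij
    refine (orderRel_of_not_modEq fun e => hij e.symm).trans ?_
    simp [Precedes, h, h.not_gt]
  ext x
  constructor
  · rintro ⟨i, j, h, hij, hlt, rfl⟩
    exact (key i j h hij).1 hlt
  · intro hx
    obtain ⟨i, j, h, hij, rfl⟩ := hJ.closed.subset hx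
    exact ⟨i, j, h, hij, (key i j h hij).2 hx, rfl⟩

/-! ### The bijection. -/

/-- The map induced by `≺ ↦ I(≺)` on equivalence classes of invariant orders. -/
def inversionMap (n : ℕ) : Quotient (InvariantOrder.reversalSetoid n) →
    {J : Set (PairClass n) // IsBiclosed n J} :=
  Quotient.lift (fun o => ⟨o.inversionSet, o.inversionSet_isBiclosed⟩)
    fun _ _ h => Subtype.ext (InvariantOrder.ReversalEquiv.inversionSet_eq h)

theorem inversionMap_bijective (n : ℕ) : Function.Bijective (inversionMap n) := by
  constructor
  · rintro ⟨o⟩ ⟨o'⟩ h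
    exact Quotient.sound
      (InvariantOrder.reversalEquiv_of_inversionSet_eq (congrArg Subtype.val h))
  · rintro ⟨J, hJ⟩
    exact ⟨Quotient.mk _ hJ.toInvariantOrder, Subtype.ext hJ.inversionSet_toInvariantOrder⟩

end AffineA

theorem mainTheorem3 (n : ℕ) (hn : 1 ≤ n) :
    ∃ Φ : Quotient (AffineA.InvariantOrder.reversalSetoid n) ≃
        {J : Set (AffineA.PairClass n) // AffineA.IsBiclosed n J},
      ∀ o : AffineA.InvariantOrder n,
        (Φ (Quotient.mk (AffineA.InvariantOrder.reversalSetoid n) o) :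
          Set (AffineA.PairClass n)) = o.inversionSet :=
  ⟨Equiv.ofBijective _ (AffineA.inversionMap_bijective n), fun _ => rfl⟩
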